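/- **Setting.** All manifolds (Hausdorff, finite-dimensional, without boundary) and maps are smooth. Let $Q$ be a manifold, $L:TQ\to\mathbb R$ a regular Lagrangian (the fibre Hessian $\partial^2L/\partial\dot q\,\partial\dot q$ is everywhere nondegenerate), $\xi_0$ a vector field on $Q$ and $\mathcal D_0$ a distribution of constant rank on $Q$, and let $$M_0=\{v_q\in TQ:\ v_q-\xi_0(q)\in(\mathcal D_0)_q\}.$$ Let $X_{L,Q,M_0}$ be the corresponding time-independent nonholonomic system with affine constraints, i.e. a vector field on $M_0$ (tangent to $M_0$) given by the restriction to $M_0$ of Lagrange equations $\dot q=v$, $\frac{d}{dt}\frac{\partial L}{\partial\dot q}-\frac{\partial L}{\partial q}=R$ for some reaction force $R$ on $M_0$ with values in the annihilator $\mathcal D_0^\circ\subset T^*Q$. Let $p(v_q)\in T_q^*Q$ be the derivative at $v_q$ of $L|_{T_qQ}$ (in coordinates $p=\partial L/\partial\dot q$), and let $E_L(v_q)=\langle p(v_q),v_q\rangle-L(v_q)$ be the energy; for a time-dependent Lagrangian on $TQ\times\mathbb R$ the energy is defined in the same way at each fixed $t$. A time-dependent diffeomorphism of $Q$ is a diffeomorphism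 $\mathcal C$ of $Q\times\mathbb R$ of the form $\mathcal C(q,t)=(\mathcal Q_t(q),t)$; it induces the bijection $D\mathcal C(v_q,t)=\big(T_q\mathcal Q_t\cdot v_q+\frac{\partial}{\partial t}\mathcal Q_t(q),\,t\big)$ of $TQ\times\mathbb R$. The moving energy induced by $\mathcal C$ is the restriction to $M_0\times\mathbb R$ of $E^*_{L,\mathcal C}:=E_{L\circ D\mathcal C}\circ D\mathcal C^{-1}:TQ\times\mathbb R\to\mathbb R$, where $L$ is regarded as a function on $TQ\times\mathbb R$ that does not depend on $t$. Let $\Psi:G\times Q\to Q$ be a smooth action of a Lie group $G$ with Lie algebra $\mathfrak g$. For $\eta\in\mathfrak g$ let $Y_\eta(q)=\frac{d}{dt}\Psi_{\exp(t\eta)}(q)|_{t=0}$ be the infinitesimal generator and $J_\eta(v_q)=\langle p(v_q),Y_\eta(q)\rangle$. **Theorem 2.** Assume that * (H1) $L(T_q\Psi_g\cdot v_q)=L(v_q)$ for all $g\in G$, $q\in Q$ and $v_q\in T_qQ$; * (H2) $(\mathcal D_0)_{\Psi_g(q)}=T_q\Psi_g\cdot(\mathcal D_0)_q$ for all $g\in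 G$ and $q\in Q$; * (H3) $\eta\in\mathfrak g$ is such that $Y_\eta-\xi_0$ is a section of $\mathcal D_0$. Then the restriction of $E_L-J_\eta$ to $M_0$ is a (time-independent) first integral of $X_{L,Q,M_0}$: it is smooth and constant along all integral curves of $X_{L,Q,M_0}$. Moreover, it is the moving energy induced by the flow of $Y_\eta$: there is exactly one time-dependent diffeomorphism $\mathcal C_\eta=(\Phi^{Y_\eta},\mathrm{id}_{\mathbb R})$ of $Q$ whose first component $\Phi^{Y_\eta}$ is the flow of $Y_\eta$, and $E^*_{L,\mathcal C_\eta}(v,t)=E_L(v)-J_\eta(v)$ for all $v\in TQ$ and $t\in\mathbb R$. -/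

import Mathlib

open scoped Manifold ContDiff Topology

noncomputable section

namespace MovingEnergy

section Lagrangian

variable {E : Type*} [NormedAddCommGroup E] [NormedSpace ℝ E]
  {H : Type*} [TopologicalSpace H] {I : ModelWithCorners ℝ E H}
  {Q : Type*} [TopologicalSpace Q] [ChartedSpace H Q]

/-- The momentum covector `p(v) ∈ T_q^* Q` of a Lagrangian `L` on `TQ`, at `v ∈ T_q Q`: the
derivative at `v` of the restriction of `L` to the vector space `T_q Q`
(in bundle coordinates, `∂L/∂q̇`). -/
def momentum (L : TangentBundle I Q → ℝ) (v : TangentBundle I Q) :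
    TangentSpace I v.proj →L[ℝ] ℝ :=
  fderiv ℝ (fun w : E ↦ L ⟨v.proj, w⟩) v.snd

/-- The energy `E_L(v) = ⟨p(v), v⟩ - L(v)` of a Lagrangian on `TQ`. -/
def energy (L : TangentBundle I Q → ℝ) (v : TangentBundle I Q) : ℝ :=
  momentum L v v.snd - L v

/-- The energy `E_L(v, t) = ⟨p(v, t), v⟩ - L(v, t)` of a time-dependent Lagrangian on `TQ × ℝ`. -/
def extendedEnergy (L : TangentBundle I Q × ℝ → ℝ) (z : TangentBundle I Q × ℝ) : ℝ :=
  energy (fun v ↦ L (v, z.2)) z.1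

/-- A Lagrangian is regular if its fibre Hessian `∂²L/∂q̇∂q̇` is everywhere nondegenerate. -/
def IsRegular (L : TangentBundle I Q → ℝ) : Prop :=
  ∀ (q : Q) (v u : E),
    (∀ w : E, fderiv ℝ (fderiv ℝ fun x : E ↦ L (⟨q, x⟩ : TangentBundle I Q)) v u w = 0) → u = 0

/-- A smooth distribution of constant rank `r`: it is locally spanned by `r` smooth vector
fields, and its fibres have dimension `r`. -/
structure IsSmoothDistribution (D : ∀ q : Q, Submodule ℝ (TangentSpace I q)) (r : ℕ)
    [IsManifold I 1 Q] : Prop where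
  finrank_eq : ∀ q, Module.finrank ℝ (D q) = r
  exists_frame : ∀ q : Q, ∃ U : Set Q, IsOpen U ∧ q ∈ U ∧
    ∃ e : Fin r → ∀ x : Q, TangentSpace I x,
      (∀ i, ContMDiffOn I I.tangent ∞ (fun x ↦ (⟨x, e i x⟩ : TangentBundle I Q)) U) ∧
      ∀ x ∈ U, D x = Submodule.span ℝ (Set.range fun i ↦ e i x)

/-- The constraint submanifold `M₀ = {v_q : v_q - ξ₀(q) ∈ (D₀)_q}` of `TQ`. -/
def constraintSubmanifold (ξ : ∀ q : Q, TangentSpace I q)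
    (D : ∀ q : Q, Submodule ℝ (TangentSpace I q)) : Set (TangentBundle I Q) :=
  {v | v.snd - ξ v.proj ∈ D v.proj}

variable [IsManifold I 1 Q]

/-- `L` in the bundle coordinates `(x, ẋ) ∈ E × E` of `TQ` induced by the chart of `Q` around the
base point of `v`. -/
def coordLagrangian (L : TangentBundle I Q → ℝ) (v : TangentBundle I Q) : E × E → ℝ :=
  L ∘ (extChartAt I.tangent v).symm

/-- The left-hand side `(d/dt) ∂L/∂q̇ - ∂L/∂q` of Lagrange equations at `v ∈ T_q Q`, where `d/dt` is
the derivative along the tangent vector `a ∈ T_v TQ`, as a covector at `q`. It is computed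
in the bundle coordinates around `v`, and moved to `T_q Q` by the differential of the chart. -/
def lagrangeCovector (L : TangentBundle I Q → ℝ) (v : TangentBundle I Q)
    (a : TangentSpace I.tangent v) : TangentSpace I v.proj →L[ℝ] ℝ :=
  let z : E × E := extChartAt I.tangent v v
  let dz : E × E := mfderiv I.tangent 𝓘(ℝ, E × E) (extChartAt I.tangent v) v a
  let p : E × E → E →L[ℝ] ℝ := fun y ↦
    (fderiv ℝ (coordLagrangian L v) y).comp (ContinuousLinearMap.inr ℝ E E)
  let force : E →L[ℝ] ℝ :=
    fderiv ℝ p z dz - (fderiv ℝ (coordLagrangian L v) z).comp (ContinuousLinearMap.inl ℝ E E)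
  force.comp (mfderiv I 𝓘(ℝ, E) (extChartAt I v.proj) v.proj)

/-- `a ∈ T_v TQ` is tangent at `v` to the subset `M` of `TQ`: it is the velocity of a smooth curve
in `M` through `v`. -/
def IsTangentTo (M : Set (TangentBundle I Q)) (v : TangentBundle I Q)
    (a : TangentSpace I.tangent v) : Prop :=
  ∃ c : ℝ → TangentBundle I Q, ContMDiffAt 𝓘(ℝ, ℝ) I.tangent ∞ c 0 ∧ c 0 = v ∧
    (∀ᶠ s in 𝓝 (0 : ℝ), c s ∈ M) ∧
    HasMFDerivAt 𝓘(ℝ, ℝ) I.tangent c 0 ((1 : ℝ →L[ℝ] ℝ).smulRight a)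

end Lagrangian

/-- The data of a time-independent nonholonomic system with affine constraints: a regular
Lagrangian `L` on `TQ` and an affine distribution `ξ + D` on `Q`. -/
structure NonholonomicData {E : Type*} [NormedAddCommGroup E] [NormedSpace ℝ E]
    {H : Type*} [TopologicalSpace H] (I : ModelWithCorners ℝ E H)
    (Q : Type*) [TopologicalSpace Q] [ChartedSpace H Q] [IsManifold I ∞ Q] where
  /-- the Lagrangian -/
  L : TangentBundle I Q → ℝ
  smooth_L : ContMDiff I.tangent 𝓘(ℝ, ℝ) ∞ L
  regular_L : IsRegular L
  /-- the nonhomogeneous part of the constraint -/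
  ξ : ∀ q : Q, TangentSpace I q
  smooth_ξ : ContMDiff I I.tangent ∞ fun q ↦ (⟨q, ξ q⟩ : TangentBundle I Q)
  /-- the constraint distribution -/
  D : ∀ q : Q, Submodule ℝ (TangentSpace I q)
  /-- the rank of the constraint distribution -/
  rank : ℕ
  smooth_D : IsSmoothDistribution D rank

section System

variable {E : Type*} [NormedAddCommGroup E] [NormedSpace ℝ E]
  {H : Type*} [TopologicalSpace H] {I : ModelWithCorners ℝ E H}
  {Q : Type*} [TopologicalSpace Q] [ChartedSpace H Q] [IsManifold I ∞ Q]

/-- The constraint submanifold of the system. -/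
def NonholonomicData.M₀ (S : NonholonomicData I Q) : Set (TangentBundle I Q) :=
  constraintSubmanifold S.ξ S.D

/-- `X` is the vector field on `M₀` given by the restriction to `M₀` of Lagrange equations
with an ideal reaction force. Only the values of `X` on `M₀` matter. -/
structure NonholonomicData.IsNonholonomicSystem (S : NonholonomicData I Q)
    (X : ∀ v : TangentBundle I Q, TangentSpace I.tangent v) : Prop where
  smooth : ContMDiffOn I.tangent I.tangent.tangent ∞
    (fun v ↦ (⟨v, X v⟩ : TangentBundle I.tangent (TangentBundle I Q))) S.M₀
  tangent : ∀ v ∈ S.M₀, IsTangentTo S.M₀ v (X v)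
  /-- `X` is a second-order vector field: the base point `q` of `v ∈ T_q Q` has velocity `v`. -/
  second_order : ∀ v ∈ S.M₀,
    mfderiv I.tangent I (fun w : TangentBundle I Q ↦ w.proj) v (X v) = v.snd
  /-- Lagrange equations with a reaction force `R : M₀ → D°`. -/
  lagrange : ∃ R : ∀ v : TangentBundle I Q, TangentSpace I v.proj →L[ℝ] ℝ,
    ∀ v ∈ S.M₀, (∀ w ∈ S.D v.proj, R v w = 0) ∧ lagrangeCovector S.L v (X v) = R v

/-- The restriction of `f` to the subset `M` of `TQ` is a first integral of the vector field `X` on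
`M`: it is smooth and it is constant along each integral curve of `X` in `M`, on any interval
`s`. -/
def IsFirstIntegral (M : Set (TangentBundle I Q))
    (X : ∀ v : TangentBundle I Q, TangentSpace I.tangent v) (f : TangentBundle I Q → ℝ) : Prop :=
  ContMDiffOn I.tangent 𝓘(ℝ, ℝ) ∞ f M ∧
    ∀ (γ : ℝ → TangentBundle I Q) (s : Set ℝ), s.OrdConnected →
      IsMIntegralCurveOn γ X s → (∀ t ∈ s, γ t ∈ M) →
        ∀ t₁ ∈ s, ∀ t₂ ∈ s, f (γ t₁) = f (γ t₂)

end System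

section Diffeo

/-- A time-dependent diffeomorphism of `U` onto `Q`: a diffeomorphism
`U × ℝ → Q × ℝ` of the form `(u, t) ↦ (𝒬(u, t), t)`. -/
@[ext]
structure TimeDependentDiffeo
    {E' : Type*} [NormedAddCommGroup E'] [NormedSpace ℝ E']
    {H' : Type*} [TopologicalSpace H'] (I' : ModelWithCorners ℝ E' H')
    {E : Type*} [NormedAddCommGroup E] [NormedSpace ℝ E]
    {H : Type*} [TopologicalSpace H] (I : ModelWithCorners ℝ E H)
    (U : Type*) [TopologicalSpace U] [ChartedSpace H' U]
    (Q : Type*) [TopologicalSpace Q] [ChartedSpace H Q] where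
  /-- the diffeomorphism of the extended spaces -/
  toDiffeo : Diffeomorph (I'.prod 𝓘(ℝ, ℝ)) (I.prod 𝓘(ℝ, ℝ)) (U × ℝ) (Q × ℝ) ∞
  time_eq : ∀ z, (toDiffeo z).2 = z.2

variable {E' : Type*} [NormedAddCommGroup E'] [NormedSpace ℝ E']
  {H' : Type*} [TopologicalSpace H'] {I' : ModelWithCorners ℝ E' H'}
  {E : Type*} [NormedAddCommGroup E] [NormedSpace ℝ E]
  {H : Type*} [TopologicalSpace H] {I : ModelWithCorners ℝ E H}
  {U : Type*} [TopologicalSpace U] [ChartedSpace H' U]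
  {Q : Type*} [TopologicalSpace Q] [ChartedSpace H Q]

namespace TimeDependentDiffeo

/-- The first component `𝒬 : U × ℝ → Q`. -/
def map (C : TimeDependentDiffeo I' I U Q) (u : U) (t : ℝ) : Q := (C.toDiffeo (u, t)).1

/-- The inverse time-dependent diffeomorphism. -/
def symm (C : TimeDependentDiffeo I' I U Q) : TimeDependentDiffeo I I' Q U where
  toDiffeo := C.toDiffeo.symm
  time_eq z := by
    rw [← C.time_eq (C.toDiffeo.symm z), C.toDiffeo.apply_symm_apply]

/-- The map `DC(v_u, t) = (T_u 𝒬_t · v_u + ∂𝒬/∂t (u, t), t)`. -/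
def lift (C : TimeDependentDiffeo I' I U Q) (z : TangentBundle I' U × ℝ) :
    TangentBundle I Q × ℝ :=
  (⟨C.map z.1.proj z.2,
    mfderiv I' I (fun u ↦ C.map u z.2) z.1.proj z.1.snd +
      mfderiv 𝓘(ℝ, ℝ) I (fun t ↦ C.map z.1.proj t) z.2 (1 : ℝ)⟩, z.2)

theorem lift_fst_eq_tangentMap (C : TimeDependentDiffeo I' I U Q) (z : TangentBundle I' U × ℝ) :
    (C.lift z).1 = tangentMap (I'.prod 𝓘(ℝ, ℝ)) I (fun y ↦ (C.toDiffeo y).1)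
      ⟨(z.1.proj, z.2), (z.1.snd, (1 : ℝ))⟩ := by
  have h : MDifferentiableAt (I'.prod 𝓘(ℝ, ℝ)) I (fun y ↦ (C.toDiffeo y).1) (z.1.proj, z.2) :=
    ((contMDiff_fst.comp C.toDiffeo.contMDiff_toFun).mdifferentiable (by simp)) _
  have h2 := mfderiv_prod_eq_add_apply
    (v := ((z.1.snd, (1 : ℝ)) : TangentSpace (I'.prod 𝓘(ℝ, ℝ)) (z.1.proj, z.2))) h
  exact congrArg (fun w ↦ (⟨_, w⟩ : TangentBundle I Q)) h2.symm

theorem tangentMap_toDiffeo (C : TimeDependentDiffeo I' I U Q) (z : TangentBundle I' U × ℝ) :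
    tangentMap (I'.prod 𝓘(ℝ, ℝ)) (I.prod 𝓘(ℝ, ℝ)) C.toDiffeo
      ⟨(z.1.proj, z.2), (z.1.snd, (1 : ℝ))⟩ =
      ⟨((C.lift z).1.proj, (C.lift z).2), ((C.lift z).1.snd, (1 : ℝ))⟩ := by
  have h : MDifferentiableAt (I'.prod 𝓘(ℝ, ℝ)) I (fun y ↦ (C.toDiffeo y).1) (z.1.proj, z.2) :=
    ((contMDiff_fst.comp C.toDiffeo.contMDiff_toFun).mdifferentiable (by simp)) _
  have hfun : ⇑C.toDiffeo = fun y : U × ℝ ↦ ((C.toDiffeo y).1, y.2) :=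
    funext fun y ↦ Prod.ext rfl (C.time_eq y)
  have h2 := mfderiv_prodMk h
    (mdifferentiableAt_snd : MDifferentiableAt (I'.prod 𝓘(ℝ, ℝ)) 𝓘(ℝ, ℝ) (Prod.snd : U × ℝ → ℝ) _)
  have h3 := congrArg (fun w : TangentBundle I Q ↦
    (⟨(w.proj, z.2), (w.snd, (1 : ℝ))⟩ :
      TangentBundle (I.prod 𝓘(ℝ, ℝ)) (Q × ℝ))) (C.lift_fst_eq_tangentMap z)
  refine Eq.trans ?_ h3.symm
  rw [hfun]
  simp only [tangentMap]
  refine congrArg (fun w ↦ (⟨_, w⟩ : TangentBundle (I.prod 𝓘(ℝ, ℝ)) (Q × ℝ))) ?_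
  rw [h2, mfderiv_snd]
  rfl

theorem symm_lift_lift (C : TimeDependentDiffeo I' I U Q) (z : TangentBundle I' U × ℝ) :
    C.symm.lift (C.lift z) = z := by
  refine Prod.ext ?_ rfl
  rw [lift_fst_eq_tangentMap, ← tangentMap_toDiffeo]
  have h1 : MDifferentiable (I'.prod 𝓘(ℝ, ℝ)) (I.prod 𝓘(ℝ, ℝ)) C.toDiffeo :=
    C.toDiffeo.contMDiff_toFun.mdifferentiable (by simp)
  have h2 : MDifferentiable (I.prod 𝓘(ℝ, ℝ)) I' (fun y ↦ (C.symm.toDiffeo y).1) :=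
    (contMDiff_fst.comp C.symm.toDiffeo.contMDiff_toFun).mdifferentiable (by simp)
  rw [← tangentMap_comp_at _ (h2 _) (h1 _)]
  have h3 : (fun y ↦ (C.symm.toDiffeo y).1) ∘ C.toDiffeo = (Prod.fst : U × ℝ → U) := by
    funext y
    exact congrArg Prod.fst (C.toDiffeo.symm_apply_apply y)
  rw [h3, tangentMap_prodFst]

/-- `DC` as a bijection; its inverse is the lift of the inverse of `C`. -/
def liftEquiv (C : TimeDependentDiffeo I' I U Q) :
    TangentBundle I' U × ℝ ≃ TangentBundle I Q × ℝ where
  toFun := C.lift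
  invFun := C.symm.lift
  left_inv := C.symm_lift_lift
  right_inv := C.symm.symm_lift_lift

end TimeDependentDiffeo

/-- The moving energy `E_{L,C}^* = E_{L ∘ DC} ∘ DC⁻¹` induced by `C`, before restriction to the
constraint manifold. -/
def movingEnergy (L : TangentBundle I Q × ℝ → ℝ) (C : TimeDependentDiffeo I' I U Q) :
    TangentBundle I Q × ℝ → ℝ :=
  extendedEnergy (L ∘ C.liftEquiv) ∘ C.liftEquiv.symm

/-- `Φ : Q × ℝ → Q` is the (global) flow of the vector field `Y`. -/
def IsFlow (Φ : Q → ℝ → Q) (Y : ∀ q : Q, TangentSpace I q) : Prop :=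
  ∀ q, Φ q 0 = q ∧ IsMIntegralCurve (Φ q) Y

end Diffeo

section Action

variable {F : Type*} [NormedAddCommGroup F] [NormedSpace ℝ F]
  {K : Type*} [TopologicalSpace K] {J : ModelWithCorners ℝ F K}
  {G : Type*} [TopologicalSpace G] [ChartedSpace K G] [Group G]

open Classical in
/-- The exponential map of a Lie group: `exp η = γ(1)`, where `γ` is the integral curve, with
`γ(0) = 1`, of the left-invariant vector field that equals `η` at the identity. (In a Hausdorff
Lie group `γ` exists and is unique.) -/
def lieExp (η : GroupLieAlgebra J G) : G :=
  if h : ∃ γ : ℝ → G, γ 0 = 1 ∧ IsMIntegralCurve γ (mulInvariantVectorField η) then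
    h.choose 1
  else 1

variable {E : Type*} [NormedAddCommGroup E] [NormedSpace ℝ E]
  {H : Type*} [TopologicalSpace H] (I : ModelWithCorners ℝ E H)
  {Q : Type*} [TopologicalSpace Q] [ChartedSpace H Q] [MulAction G Q]

/-- The infinitesimal generator `Y_η(q) = (d/dt) Ψ_{exp(tη)}(q)` at `t = 0`. The derivative is a
tangent vector at `exp(0) • q`, which is the point `q`. -/
def infinitesimalGenerator (η : GroupLieAlgebra J G) (q : Q) : TangentSpace I q :=
  (mfderiv 𝓘(ℝ, ℝ) I (fun t : ℝ ↦ lieExp (t • η) • q) 0 (1 : ℝ) : E)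

/-- The momentum map component `J_η = ⟨p, Y_η⟩` of the lifted action. -/
def momentumMap {I : ModelWithCorners ℝ E H} (L : TangentBundle I Q → ℝ)
    (η : GroupLieAlgebra J G) (v : TangentBundle I Q) : ℝ :=
  momentum L v (infinitesimalGenerator I η v.proj)

end Action

end MovingEnergy

end

/-! Write `Y` for the infinitesimal generator of `η`. Differentiating the invariance of `L` along
the flow of `Y` gives, in bundle coordinates, `∂L/∂q · Y + ∂L/∂q̇ · (DY q̇) = 0`
(`fderiv_coordLagrangian_tangentLift`). Together with the product rule this shows that along any
second-order vector the derivative of `E_L - ⟨p, Y⟩` is the Lagrange covector evaluated on `v - Y`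
(`mfderiv_energy_sub_momentum_of_invariant`). On the constraint manifold this covector is the
reaction force, which annihilates `D`, while `v - Y = (v - ξ) - (Y - ξ)` lies in `D`. Hence the
derivative along `X` vanishes.

For the moving energy, the lift of the flow is on each fibre an affine map `w ↦ A w + b`, with `b`
the value of `Y`. At `v = A w + b` the fibre derivative of the pulled-back Lagrangian, evaluated on
`w`, is `p(v)(A w) = p(v)(v) - p(v)(b)`, so the energy drops by exactly `⟨p, Y⟩`
(`extendedEnergy_comp_lift`).

The flow is global because left-invariant fields are complete: it is the action of the one-parameter
subgroup `t ↦ exp (t η)`. Uniqueness is that of integral curves. -/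

namespace MovingEnergy

open Bundle

/-! ### Curves and integral curves on manifolds. -/

section Curves

variable {E : Type*} [NormedAddCommGroup E] [NormedSpace ℝ E]
  {H : Type*} [TopologicalSpace H] {I : ModelWithCorners ℝ E H}
  {M : Type*} [TopologicalSpace M] [ChartedSpace H M]
  {E' : Type*} [NormedAddCommGroup E'] [NormedSpace ℝ E']
  {H' : Type*} [TopologicalSpace H'] {I' : ModelWithCorners ℝ E' H'}
  {N : Type*} [TopologicalSpace N] [ChartedSpace H' N]
  {E'' : Type*} [NormedAddCommGroup E''] [NormedSpace ℝ E'']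
  {H'' : Type*} [TopologicalSpace H''] {I'' : ModelWithCorners ℝ E'' H''}
  {P : Type*} [TopologicalSpace P] [ChartedSpace H'' P]

theorem tangentBundle_mk_congr {a b : M} (h : a = b) (u : E) :
    (⟨a, u⟩ : TangentBundle I M) = ⟨b, u⟩ := by
  subst h
  rfl

theorem hasMFDerivWithinAt_comp_curve {f : M → N} {γ : ℝ → M} {s : Set ℝ} {t : ℝ}
    {a : TangentSpace I (γ t)} {A : TangentSpace I (γ t) →L[ℝ] TangentSpace I' (f (γ t))}
    (hf : HasMFDerivAt I I' f (γ t) A)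
    (hγ : HasMFDerivWithinAt 𝓘(ℝ, ℝ) I γ s t ((1 : ℝ →L[ℝ] ℝ).smulRight a)) :
    HasMFDerivWithinAt 𝓘(ℝ, ℝ) I' (fun t ↦ f (γ t)) s t
      ((1 : ℝ →L[ℝ] ℝ).smulRight (A a)) := by
  refine (hf.comp_hasMFDerivWithinAt t hγ).congr_mfderiv ?_
  exact ContinuousLinearMap.ext fun x : ℝ ↦ (A : E →L[ℝ] E').map_smul x a

/-- The partial derivative of a smooth map in its second variable, along a fixed vector, depends
smoothly on the first variable. -/
theorem contMDiff_mfderiv_snd [IsManifold I ∞ M] [IsManifold I' ∞ N] [IsManifold I'' ∞ P]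
    {Φ : M → N → P}
    (hΦ : ContMDiff (I.prod I') I'' ∞ fun p : M × N ↦ Φ p.1 p.2) (n : N)
    (w : TangentSpace I' n) :
    ContMDiff I I''.tangent ∞
      fun m ↦ (⟨Φ m n, mfderiv I' I'' (Φ m) n w⟩ : TangentBundle I'' P) := by
  -- The map is the tangent map of `Φ` evaluated on the pair (zero vector at `m`, `w`), which
  -- depends smoothly on `m`.
  have h1 : ContMDiff I I.tangent ∞ fun m : M ↦ (⟨m, 0⟩ : TangentBundle I M) :=
    contMDiff_zeroSection _ _
  have h2 : ContMDiff I I'.tangent ∞ fun _ : M ↦ (⟨n, w⟩ : TangentBundle I' N) :=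
    contMDiff_const
  have h3 : ContMDiff (I.tangent.prod I'.tangent) (I.prod I').tangent ∞
      (equivTangentBundleProd I M I' N).symm := contMDiff_equivTangentBundleProd_symm
  have h4 := hΦ.contMDiff_tangentMap (m := ∞) (by simp)
  have h5 := (h4.comp h3).comp (h1.prodMk h2)
  refine h5.congr fun m ↦ ?_
  have h6 := mfderiv_prod_eq_add_apply (v := ((0, w) : TangentSpace (I.prod I') (m, n)))
    (hΦ.mdifferentiableAt (by simp) : MDifferentiableAt _ _ _ (m, n))
  refine congrArg (fun w ↦ (⟨Φ m n, w⟩ : TangentBundle I'' P)) ?_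
  refine Eq.trans ?_ h6.symm
  have h7 : (mfderiv I I'' (fun x ↦ Φ x n) m : E →L[ℝ] E'') 0 = 0 := map_zero _
  exact (zero_add (mfderiv I' I'' (Φ m) n w : E'')).symm.trans
    (congrArg (· + (mfderiv I' I'' (Φ m) n w : E'')) h7.symm)

/-- An integral curve of a smooth vector field is smooth. -/
theorem contMDiff_of_isMIntegralCurve [I.Boundaryless] [IsManifold I ∞ M]
    {v : ∀ x : M, TangentSpace I x} {γ : ℝ → M}
    (hv : ContMDiff I I.tangent ∞ fun x ↦ (⟨x, v x⟩ : TangentBundle I M))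
    (hγ : IsMIntegralCurve γ v) : ContMDiff 𝓘(ℝ, ℝ) I ∞ γ := by
  have hcont : Continuous γ :=
    continuous_iff_continuousAt.2 fun t ↦ (hγ t).continuousAt
  -- Bootstrap: if `γ` is `C^n`, so is `v ∘ γ`. Read in a chart this is the velocity of `γ`, hence
  -- `γ` is `C^(n+1)`.
  suffices h : ∀ n : ℕ, ContMDiff 𝓘(ℝ, ℝ) I n γ from contMDiff_infty.2 h
  intro n
  induction n with
  | zero => exact contMDiff_zero_iff.2 hcont
  | succ n ih =>
    intro t₀
    have h1 : ContMDiffAt 𝓘(ℝ, ℝ) I.tangent n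
        (fun t ↦ (⟨γ t, v (γ t)⟩ : TangentBundle I M)) t₀ :=
      ((hv.of_le (by exact_mod_cast le_top)).comp ih) t₀
    have h2 := (contMDiffAt_totalSpace.1 h1).2
    rw [contMDiffAt_iff_contDiffAt] at h2
    have h3 := (hγ.isMIntegralCurveAt t₀).eventually_hasDerivAt
    rw [contMDiffAt_iff_target]
    refine ⟨hcont.continuousAt, ?_⟩
    rw [contMDiffAt_iff_contDiffAt]
    refine (contDiffAt_succ_iff_hasFDerivAt (n := n)).2
      ⟨_, ⟨_, h3, fun t ht ↦ HasDerivAt.hasFDerivAt ht⟩, ?_⟩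
    exact (ContinuousLinearMap.smulRightL ℝ ℝ E
      (1 : ℝ →L[ℝ] ℝ)).contDiff.contDiffAt.comp t₀ h2

end Curves

/-! ### Left-invariant vector fields and one-parameter subgroups. -/

section OneParameter

variable {F : Type*} [NormedAddCommGroup F] [NormedSpace ℝ F]
  {K : Type*} [TopologicalSpace K] {J : ModelWithCorners ℝ F K}
  {G : Type*} [TopologicalSpace G] [ChartedSpace K G] [Group G] [LieGroup J ∞ G]

theorem contMDiff_mulInvariantVectorField_infty (η : GroupLieAlgebra J G) :
    ContMDiff J J.tangent ∞
      fun g : G ↦ (⟨g, mulInvariantVectorField η g⟩ : TangentBundle J G) := by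
  have : IsManifold J ∞ G := LieGroup.toContMDiffMul.toIsManifold
  have h := contMDiff_mfderiv_snd (Φ := fun g h : G ↦ g * h) (contMDiff_mul J ∞) 1 η
  exact h.congr fun g ↦ tangentBundle_mk_congr (mul_one g).symm _

theorem mfderiv_mul_left_mulInvariantVectorField (η : GroupLieAlgebra J G) (g h : G) :
    (mfderiv J J (g * ·) h (mulInvariantVectorField η h) : F) =
      mulInvariantVectorField η (g * h) := by
  have h1 : (fun x : G ↦ g * h * x) = (g * ·) ∘ (h * ·) := by
    funext x; exact mul_assoc _ _ _
  have hd : ∀ a x : G, MDifferentiableAt J J (a * ·) x := fun a x ↦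
    (contMDiff_mul_left (I := J) (n := ∞)).mdifferentiableAt (by simp)
  have h2 : mulInvariantVectorField η (g * h) =
      (mfderiv J J ((g * ·) ∘ (h * ·)) 1 η : F) := by
    simp only [mulInvariantVectorField]
    rw [h1]
    rfl
  rw [h2, mfderiv_comp (I' := J) _ (hd _ _) (hd _ _)]
  simp only [mulInvariantVectorField]
  -- The chain rule differentiates `(g * ·)` at `h * 1`, equal to `h` only propositionally; the
  -- tangent spaces are retyped as `F` so that the rewrite goes through.
  have h3 : h * 1 = h := mul_one h
  change _ = (mfderiv J J (g * ·) (h * 1) : F →L[ℝ] F) _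
  rw [h3]
  rfl

theorem isMIntegralCurveOn_mul_left {η : GroupLieAlgebra J G} {γ : ℝ → G} {s : Set ℝ} (g : G)
    (hγ : IsMIntegralCurveOn γ (mulInvariantVectorField η) s) :
    IsMIntegralCurveOn (fun t ↦ g * γ t) (mulInvariantVectorField η) s := by
  intro t ht
  have hd : HasMFDerivAt J J (g * ·) (γ t) (mfderiv J J (g * ·) (γ t)) :=
    ((contMDiff_mul_left (I := J) (n := ∞)).mdifferentiableAt (by simp)).hasMFDerivAt
  rw [← mfderiv_mul_left_mulInvariantVectorField]
  exact hasMFDerivWithinAt_comp_curve hd (hγ t ht)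

variable [FiniteDimensional ℝ F] [J.Boundaryless] [T2Space G]

/-- A left-invariant vector field has a global integral curve through the identity. -/
theorem exists_isMIntegralCurve_mulInvariantVectorField (η : GroupLieAlgebra J G) :
    ∃ γ : ℝ → G, γ 0 = 1 ∧ IsMIntegralCurve γ (mulInvariantVectorField η) := by
  have : IsManifold J ∞ G := LieGroup.toContMDiffMul.toIsManifold
  have hv : ContMDiff J J.tangent 1
      fun g : G ↦ (⟨g, mulInvariantVectorField η g⟩ : TangentBundle J G) :=
    (contMDiff_mulInvariantVectorField_infty η).of_le (by exact_mod_cast le_top)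
  have : CompleteSpace F := FiniteDimensional.complete ℝ F
  obtain ⟨γ, h0, hγ⟩ := exists_isMIntegralCurveAt_of_contMDiffAt_boundaryless 0
    (hv.contMDiffAt (x := 1))
  obtain ⟨ε, hε, hγ⟩ := isMIntegralCurveAt_iff'.1 hγ
  rw [Real.ball_eq_Ioo, zero_sub, zero_add] at hγ
  -- Left translates of the local curve through `1` provide, at every point, an integral curve on
  -- the same interval `(-ε, ε)`; a uniform lifetime implies completeness.
  exact exists_isMIntegralCurve_of_isMIntegralCurveOn hv hε
    (fun g ↦ ⟨fun t ↦ g * γ t, by simp [h0], isMIntegralCurveOn_mul_left g hγ⟩) 1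

/-- The curve `t ↦ exp (t η)` is the integral curve of the left-invariant vector field of `η`
through the identity. -/
theorem isMIntegralCurve_lieExp (η : GroupLieAlgebra J G) :
    IsMIntegralCurve (fun t : ℝ ↦ (lieExp (t • η) : G)) (mulInvariantVectorField η) := by
  have : IsManifold J ∞ G := LieGroup.toContMDiffMul.toIsManifold
  obtain ⟨γ, h0, hγ⟩ := exists_isMIntegralCurve_mulInvariantVectorField η
  have hexp : (fun t : ℝ ↦ (lieExp (t • η) : G)) = γ := by
    funext t
    have hex := exists_isMIntegralCurve_mulInvariantVectorField (t • η)
    -- Rescaling time by `t` turns `γ` into the curve that defines `lieExp (t • η)`, whose value at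
    -- time `1` is therefore `γ t`.
    have h1 := hγ.comp_mul t
    rw [← mulInvariantVectorField_smul] at h1
    have hv : ContMDiff J J.tangent 1
        fun g : G ↦ (⟨g, mulInvariantVectorField (t • η) g⟩ : TangentBundle J G) :=
      (contMDiff_mulInvariantVectorField_infty _).of_le (by exact_mod_cast le_top)
    have h2 := isMIntegralCurve_Ioo_eq_of_contMDiff_boundaryless (t₀ := 0) hv
      hex.choose_spec.2 h1 (by simp [hex.choose_spec.1, h0])
    rw [lieExp, dif_pos hex, h2]
    simp
  rw [hexp]
  exact hγ

/-- The left-invariant field of `0` vanishes, so the constant curve at `1` is its integral curve. -/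
theorem lieExp_zero : (lieExp (0 : GroupLieAlgebra J G) : G) = 1 := by
  have hex := exists_isMIntegralCurve_mulInvariantVectorField (0 : GroupLieAlgebra J G)
  have : IsManifold J ∞ G := LieGroup.toContMDiffMul.toIsManifold
  have hv : ContMDiff J J.tangent 1
      fun g : G ↦ (⟨g, mulInvariantVectorField (0 : GroupLieAlgebra J G) g⟩ : TangentBundle J G) :=
    (contMDiff_mulInvariantVectorField_infty _).of_le (by exact_mod_cast le_top)
  have h2 := isMIntegralCurve_Ioo_eq_of_contMDiff_boundaryless (t₀ := 0) hv
      hex.choose_spec.2 (isMIntegralCurve_const (x := 1)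
        (by simp only [mulInvariantVectorField]; exact map_zero _)) hex.choose_spec.1
  rw [lieExp, dif_pos hex, h2]

/-- As functions of `t`, both sides are integral curves of the same left-invariant field, one by
time shift and one by left translation, and they agree at `t = 0`. -/
theorem lieExp_add_smul (η : GroupLieAlgebra J G) (s t : ℝ) :
    (lieExp ((s + t) • η) : G) = lieExp (s • η) * lieExp (t • η) := by
  have : IsManifold J ∞ G := LieGroup.toContMDiffMul.toIsManifold
  have hv : ContMDiff J J.tangent 1
      fun g : G ↦ (⟨g, mulInvariantVectorField η g⟩ : TangentBundle J G) :=
    (contMDiff_mulInvariantVectorField_infty _).of_le (by exact_mod_cast le_top)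
  have h1 := (isMIntegralCurve_lieExp η).comp_add s
  have h2 := isMIntegralCurve_iff_isMIntegralCurveOn.2 (isMIntegralCurveOn_mul_left
    (lieExp (s • η)) ((isMIntegralCurve_lieExp η).isMIntegralCurveOn Set.univ))
  have h3 := isMIntegralCurve_Ioo_eq_of_contMDiff_boundaryless (t₀ := 0) hv h1 h2
    (by simp [lieExp_zero])
  simpa [add_comm] using congrFun h3 t

theorem contMDiff_lieExp_smul (η : GroupLieAlgebra J G) :
    ContMDiff 𝓘(ℝ, ℝ) J ∞ fun t : ℝ ↦ (lieExp (t • η) : G) :=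
  have : IsManifold J ∞ G := LieGroup.toContMDiffMul.toIsManifold
  contMDiff_of_isMIntegralCurve (contMDiff_mulInvariantVectorField_infty η)
    (isMIntegralCurve_lieExp η)

end OneParameter

/-! ### Fibre derivatives, the moving energy of a flow, and uniqueness of the flow. -/

section Fibre

variable {E : Type*} [NormedAddCommGroup E] [NormedSpace ℝ E]
  {H : Type*} [TopologicalSpace H] {I : ModelWithCorners ℝ E H}
  {Q : Type*} [TopologicalSpace Q] [ChartedSpace H Q] [IsManifold I ∞ Q]

/-- In a trivialization the inclusion of a fibre is a coordinate change, which is continuous and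
linear. -/
theorem contMDiff_tangentBundle_mk (q : Q) :
    ContMDiff 𝓘(ℝ, E) I.tangent ∞ fun w : E ↦ (⟨q, w⟩ : TangentBundle I Q) := by
  intro w₀
  rw [contMDiffAt_totalSpace]
  refine ⟨contMDiffAt_const, ?_⟩
  have h : (fun w : E ↦ (trivializationAt E (TangentSpace I) q (⟨q, w⟩ : TangentBundle I Q)).2) =
      fun w : E ↦ tangentCoordChange I q q q w := rfl
  change ContMDiffAt _ _ _
    (fun w : E ↦ (trivializationAt E (TangentSpace I) q (⟨q, w⟩ : TangentBundle I Q)).2) w₀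
  rw [h]
  exact (tangentCoordChange I q q q).contMDiff.contMDiffAt

theorem differentiable_fibre {L : TangentBundle I Q → ℝ}
    (hL : ContMDiff I.tangent 𝓘(ℝ, ℝ) ∞ L) (q : Q) :
    Differentiable ℝ fun w : E ↦ L ⟨q, w⟩ :=
  (contMDiff_iff_contDiff.1 (hL.comp (contMDiff_tangentBundle_mk q))).differentiable (by simp)

/-- The energy of `L ∘ DC`, for a time-dependent diffeomorphism `C` that is the flow of `Y`. -/
theorem extendedEnergy_comp_lift {L : TangentBundle I Q → ℝ}
    (hL : ContMDiff I.tangent 𝓘(ℝ, ℝ) ∞ L) {Y : ∀ q : Q, TangentSpace I q}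
    (C : TimeDependentDiffeo I I Q Q) (hC : IsFlow C.map Y) (z : TangentBundle I Q × ℝ) :
    extendedEnergy ((fun z ↦ L z.1) ∘ C.lift) z =
      energy L (C.lift z).1 - momentum L (C.lift z).1 (Y (C.lift z).1.proj) := by
  obtain ⟨⟨q, w'⟩, t⟩ := z
  obtain ⟨w, rfl⟩ : ∃ w : E, w = w' := ⟨w', rfl⟩
  let A : E →L[ℝ] E := mfderiv I I (fun u ↦ C.map u t) q
  have hb : (mfderiv 𝓘(ℝ, ℝ) I (fun t ↦ C.map q t) t (1 : ℝ) : E) = Y (C.map q t) := by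
    rw [((hC q).2 t).mfderiv]
    exact one_smul ℝ (Y (C.map q t) : E)
  let b : E := Y (C.map q t)
  have hlift : ∀ u : E, (C.lift (⟨q, u⟩, t)).1 = ⟨C.map q t, A u + b⟩ := fun u ↦
    congrArg (fun y : E ↦ (⟨C.map q t, A u + y⟩ : TangentBundle I Q)) hb
  let ℓ : E → ℝ := fun y ↦ L ⟨C.map q t, y⟩
  have hℓ : Differentiable ℝ ℓ := differentiable_fibre hL _
  have hder : fderiv ℝ (fun u : E ↦ L (C.lift (⟨q, u⟩, t)).1) w =
      (fderiv ℝ ℓ (A w + b)).comp A := by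
    have h1 : (fun u : E ↦ L (C.lift (⟨q, u⟩, t)).1) = fun u : E ↦ ℓ (A u + b) :=
      funext fun u ↦ congrArg L (hlift u)
    rw [h1]
    exact ((hℓ _).hasFDerivAt.comp w (A.hasFDerivAt.add_const b)).fderiv
  -- Here `A w = (A w + b) - b` splits off the momentum term.
  have hgoal : fderiv ℝ (fun u : E ↦ L (C.lift (⟨q, u⟩, t)).1) w w - ℓ (A w + b) =
      (fderiv ℝ ℓ (A w + b) (A w + b) - ℓ (A w + b)) - fderiv ℝ ℓ (A w + b) b := by
    rw [hder, map_add, ContinuousLinearMap.comp_apply]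
    ring
  have hR : ∀ y : E, (fderiv ℝ ℓ y y - ℓ y) - fderiv ℝ ℓ y b =
      energy L ⟨C.map q t, y⟩ - momentum L (⟨C.map q t, y⟩ : TangentBundle I Q)
        (Y (C.map q t)) := fun y ↦ rfl
  have h1 : extendedEnergy ((fun z ↦ L z.1) ∘ C.lift) ((⟨q, w⟩ : TangentBundle I Q), t) =
      fderiv ℝ (fun u : E ↦ L (C.lift (⟨q, u⟩, t)).1) w w - L (C.lift (⟨q, w⟩, t)).1 := rfl
  rw [h1, hlift w]
  exact hgoal

theorem movingEnergy_eq {L : TangentBundle I Q → ℝ}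
    (hL : ContMDiff I.tangent 𝓘(ℝ, ℝ) ∞ L) {Y : ∀ q : Q, TangentSpace I q}
    (C : TimeDependentDiffeo I I Q Q) (hC : IsFlow C.map Y) (v : TangentBundle I Q) (t : ℝ) :
    movingEnergy (fun z ↦ L z.1) C (v, t) = energy L v - momentum L v (Y v.proj) := by
  have h := extendedEnergy_comp_lift hL C hC (C.liftEquiv.symm (v, t))
  have h2 : C.lift (C.liftEquiv.symm (v, t)) = (v, t) := C.liftEquiv.apply_symm_apply (v, t)
  rw [h2] at h
  exact h

theorem isFlow_unique [I.Boundaryless] [T2Space Q] {Y : ∀ q : Q, TangentSpace I q}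
    (hY : ContMDiff I I.tangent ∞ fun q ↦ (⟨q, Y q⟩ : TangentBundle I Q))
    {C C' : TimeDependentDiffeo I I Q Q} (hC : IsFlow C.map Y) (hC' : IsFlow C'.map Y) :
    C = C' := by
  refine TimeDependentDiffeo.ext (Diffeomorph.ext fun ⟨q, t⟩ ↦ Prod.ext ?_ ?_)
  · have h := isMIntegralCurve_Ioo_eq_of_contMDiff_boundaryless (t₀ := 0)
      (hY.of_le (by exact_mod_cast le_top)) (hC q).2 (hC' q).2 ((hC q).1.trans (hC' q).1.symm)
    exact congrFun h t
  · rw [C.time_eq, C'.time_eq]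

end Fibre

/-! ### The flow of an infinitesimal generator. -/

section Action

variable {F : Type*} [NormedAddCommGroup F] [NormedSpace ℝ F] [FiniteDimensional ℝ F]
  {K : Type*} [TopologicalSpace K] {J : ModelWithCorners ℝ F K} [J.Boundaryless]
  {G : Type*} [TopologicalSpace G] [T2Space G] [ChartedSpace K G] [Group G] [LieGroup J ∞ G]
  {E : Type*} [NormedAddCommGroup E] [NormedSpace ℝ E]
  {H : Type*} [TopologicalSpace H] (I : ModelWithCorners ℝ E H)
  {Q : Type*} [TopologicalSpace Q] [ChartedSpace H Q]
  [MulAction G Q] [ContMDiffSMul J I ∞ G Q]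

theorem contMDiff_lieExp_smul_smul (η : GroupLieAlgebra J G) :
    ContMDiff (I.prod 𝓘(ℝ, ℝ)) I ∞ fun p : Q × ℝ ↦ (lieExp (p.2 • η) : G) • p.1 :=
  (contMDiff_smul (I := J) (I' := I) (n := ∞) (G := G) (M := Q)).comp
    (((contMDiff_lieExp_smul η).comp contMDiff_snd).prodMk contMDiff_fst)

theorem mdifferentiableAt_lieExp_smul_smul (η : GroupLieAlgebra J G) (q : Q) (t : ℝ) :
    MDifferentiableAt 𝓘(ℝ, ℝ) I (fun t : ℝ ↦ (lieExp (t • η) : G) • q) t :=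
  ((contMDiff_lieExp_smul_smul I η).comp
    (contMDiff_const.prodMk contMDiff_id : ContMDiff 𝓘(ℝ, ℝ) (I.prod 𝓘(ℝ, ℝ)) ∞
      fun t : ℝ ↦ (q, t))).mdifferentiableAt (by simp)

theorem contMDiff_infinitesimalGenerator [IsManifold I ∞ Q] (η : GroupLieAlgebra J G) :
    ContMDiff I I.tangent ∞
      fun q : Q ↦ (⟨q, infinitesimalGenerator I η q⟩ : TangentBundle I Q) := by
  have h := contMDiff_mfderiv_snd (Φ := fun (q : Q) (t : ℝ) ↦ (lieExp (t • η) : G) • q)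
    (contMDiff_lieExp_smul_smul I η) 0 (1 : ℝ)
  refine h.congr fun q ↦ tangentBundle_mk_congr ?_ _
  rw [zero_smul, lieExp_zero, one_smul]

theorem isFlow_lieExp_smul_smul (η : GroupLieAlgebra J G) :
    IsFlow (fun (q : Q) (t : ℝ) ↦ (lieExp (t • η) : G) • q) (infinitesimalGenerator I η) := by
  refine fun q ↦ ⟨?_, fun t ↦ ?_⟩
  · change (lieExp ((0 : ℝ) • η) : G) • q = q
    rw [zero_smul, lieExp_zero, one_smul]
  -- The group law moves the derivative at time `t` to time `0` at the point `exp (t η) • q`. The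
  -- time `0` is written `t + -t` to match the shift `s ↦ s + -t` evaluated at `t`.
  have h0 : HasMFDerivAt 𝓘(ℝ, ℝ) I
      (fun s : ℝ ↦ (lieExp (s • η) : G) • (lieExp (t • η) : G) • q) (t + -t)
      ((1 : ℝ →L[ℝ] ℝ).smulRight (infinitesimalGenerator I η ((lieExp (t • η) : G) • q))) := by
    rw [add_neg_cancel]
    refine (mdifferentiableAt_lieExp_smul_smul I η _ 0).hasMFDerivAt.congr_mfderiv ?_
    refine ContinuousLinearMap.ext_ring ?_
    exact (one_smul ℝ (infinitesimalGenerator I η ((lieExp (t • η) : G) • q) : E)).symm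
  have h1 : HasMFDerivAt 𝓘(ℝ, ℝ) 𝓘(ℝ, ℝ) (fun s : ℝ ↦ s + -t) t
      (ContinuousLinearMap.id ℝ ℝ) :=
    ((hasFDerivAt_id t).add_const (-t)).hasMFDerivAt
  have h2 := h0.comp t h1
  have h3 : (fun s : ℝ ↦ (lieExp (s • η) : G) • (lieExp (t • η) : G) • q) ∘ (fun s : ℝ ↦ s + -t) =
      fun s : ℝ ↦ (lieExp (s • η) : G) • q := by
    funext s
    rw [Function.comp_apply, ← mul_smul, ← lieExp_add_smul, neg_add_cancel_right]
  rw [h3] at h2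
  exact h2

/-- The flow of an infinitesimal generator, as a time-dependent diffeomorphism. -/
noncomputable def flowDiffeo (η : GroupLieAlgebra J G) : TimeDependentDiffeo I I Q Q where
  toDiffeo :=
    { toFun := fun p ↦ ((lieExp (p.2 • η) : G) • p.1, p.2)
      invFun := fun p ↦ ((lieExp ((-p.2) • η) : G) • p.1, p.2)
      left_inv := fun p ↦ by
        simp only [← mul_smul, ← lieExp_add_smul, neg_add_cancel]
        rw [zero_smul, lieExp_zero, one_smul]
      right_inv := fun p ↦ by
        simp only [← mul_smul, ← lieExp_add_smul, add_neg_cancel]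
        rw [zero_smul, lieExp_zero, one_smul]
      contMDiff_toFun := (contMDiff_lieExp_smul_smul I η).prodMk contMDiff_snd
      contMDiff_invFun :=
        ((contMDiff_lieExp_smul_smul I η).comp
          (contMDiff_fst.prodMk (contDiff_neg.contMDiff.comp contMDiff_snd))).prodMk
          contMDiff_snd }
  time_eq _ := rfl

theorem existsUnique_isFlow [IsManifold I ∞ Q] [I.Boundaryless] [T2Space Q] (η : GroupLieAlgebra J G) :
    ∃! C : TimeDependentDiffeo I I Q Q, IsFlow C.map (infinitesimalGenerator I η) :=
  ⟨flowDiffeo I η, isFlow_lieExp_smul_smul I η, fun _ hC ↦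
    isFlow_unique (contMDiff_infinitesimalGenerator I η) hC (isFlow_lieExp_smul_smul I η)⟩

end Action

/-! ### The two computations in a vector space. -/

section Calculus

variable {E : Type*} [NormedAddCommGroup E] [NormedSpace ℝ E]

/-- Infinitesimal form, in coordinates, of the invariance of a function on the tangent bundle under
the tangent lift of a flow `φ` with generator `Y`. -/
theorem fderiv_tangentLift_eq_zero {ℓ : E × E → ℝ} {φ : ℝ × E → E} {Y : E → E} {x₀ y₀ : E} {c : ℝ}
    (hℓ : DifferentiableAt ℝ ℓ (x₀, y₀)) (hφ : ContDiffAt ℝ 2 φ (0, x₀))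
    (hx : φ (0, x₀) = x₀) (hy : fderiv ℝ φ (0, x₀) (0, y₀) = y₀)
    (hinv : ∀ᶠ s in 𝓝 (0 : ℝ), ℓ (φ (s, x₀), fderiv ℝ φ (s, x₀) (0, y₀)) = c)
    (hY : ∀ᶠ x in 𝓝 x₀, Y x = fderiv ℝ φ (0, x) (1, 0)) :
    fderiv ℝ ℓ (x₀, y₀) (Y x₀, fderiv ℝ Y x₀ y₀) = 0 := by
  have h1 : HasFDerivAt φ (fderiv ℝ φ (0, x₀)) (0, x₀) :=
    (hφ.differentiableAt (by norm_num)).hasFDerivAt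
  have h2 : HasFDerivAt (fderiv ℝ φ) (fderiv ℝ (fderiv ℝ φ) (0, x₀)) (0, x₀) :=
    ((hφ.fderiv_right (m := 1) (by norm_num)).differentiableAt (by norm_num)).hasFDerivAt
  -- Symmetry of second derivatives identifies the time derivative of `D φ_s y₀` at `s = 0` with `DY
  -- y₀`.
  have hsymm : fderiv ℝ (fderiv ℝ φ) (0, x₀) (1, 0) (0, y₀) =
      fderiv ℝ (fderiv ℝ φ) (0, x₀) (0, y₀) (1, 0) :=
    (hφ.isSymmSndFDerivAt (by simp)).eq _ _
  have hs : HasDerivAt (fun s : ℝ ↦ (s, x₀)) (1, 0) (0 : ℝ) :=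
    (hasDerivAt_id _).prodMk (hasDerivAt_const _ _)
  have hx' : HasFDerivAt (fun x : E ↦ ((0 : ℝ), x)) (ContinuousLinearMap.inr ℝ ℝ E) x₀ :=
    hasFDerivAt_prodMk_right 0 x₀
  have hd1 : HasDerivAt (fun s : ℝ ↦ φ (s, x₀)) (fderiv ℝ φ (0, x₀) (1, 0)) 0 :=
    h1.comp_hasDerivAt (0 : ℝ) hs
  have hd2 : HasDerivAt (fun s : ℝ ↦ fderiv ℝ φ (s, x₀) (0, y₀))
      (fderiv ℝ (fderiv ℝ φ) (0, x₀) (1, 0) (0, y₀)) 0 :=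
    (ContinuousLinearMap.apply ℝ E ((0, y₀) : ℝ × E)).hasFDerivAt.comp_hasDerivAt (0 : ℝ)
      (h2.comp_hasDerivAt (0 : ℝ) hs)
  have hYd : HasFDerivAt Y ((ContinuousLinearMap.apply ℝ E ((1, 0) : ℝ × E)).comp
      ((fderiv ℝ (fderiv ℝ φ) (0, x₀)).comp (ContinuousLinearMap.inr ℝ ℝ E))) x₀ :=
    ((ContinuousLinearMap.apply ℝ E ((1, 0) : ℝ × E)).hasFDerivAt.comp x₀
      (h2.comp x₀ hx')).congr_of_eventuallyEq hY
  have hℓ' : HasFDerivAt ℓ (fderiv ℝ ℓ (x₀, y₀)) (φ (0, x₀), fderiv ℝ φ (0, x₀) (0, y₀)) := by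
    rw [hx, hy]
    exact hℓ.hasFDerivAt
  have h3 := (hℓ'.comp_hasDerivAt (0 : ℝ) (hd1.prodMk hd2)).unique
    ((hasDerivAt_const (0 : ℝ) c).congr_of_eventuallyEq hinv)
  rw [hYd.fderiv, hY.self_of_nhds]
  simp only [ContinuousLinearMap.comp_apply, ContinuousLinearMap.inr_apply,
    ContinuousLinearMap.apply_apply]
  rw [← hsymm]
  exact h3

/-- The derivative of the energy minus the momentum component of `Y`, in coordinates, along a
second-order vector `(y₀, a)`. -/
theorem fderiv_energy_sub_momentum {ℓ : E × E → ℝ} {Y : E → E} {x₀ y₀ : E} (a : E)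
    (hℓ : ContDiffAt ℝ 2 ℓ (x₀, y₀)) (hY : DifferentiableAt ℝ Y x₀)
    (hinv : fderiv ℝ ℓ (x₀, y₀) (Y x₀, fderiv ℝ Y x₀ y₀) = 0) :
    fderiv ℝ (fun w : E × E ↦ fderiv ℝ ℓ w (0, w.2 - Y w.1) - ℓ w) (x₀, y₀) (y₀, a) =
      (fderiv ℝ (fun w : E × E ↦ (fderiv ℝ ℓ w).comp (ContinuousLinearMap.inr ℝ E E)) (x₀, y₀)
        (y₀, a) - (fderiv ℝ ℓ (x₀, y₀)).comp (ContinuousLinearMap.inl ℝ E E)) (y₀ - Y x₀) := by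
  set p : E × E → E →L[ℝ] ℝ := fun w ↦ (fderiv ℝ ℓ w).comp (ContinuousLinearMap.inr ℝ E E) with hp
  have h1 : HasFDerivAt ℓ (fderiv ℝ ℓ (x₀, y₀)) (x₀, y₀) :=
    (hℓ.differentiableAt (by norm_num)).hasFDerivAt
  have h2 : DifferentiableAt ℝ (fderiv ℝ ℓ) (x₀, y₀) :=
    (hℓ.fderiv_right (m := 1) (by norm_num)).differentiableAt (by norm_num)
  have hpd : HasFDerivAt p (fderiv ℝ p (x₀, y₀)) (x₀, y₀) :=
    (h2.clm_comp (differentiableAt_const _)).hasFDerivAt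
  have h3 : HasFDerivAt (fun w : E × E ↦ w.2 - Y w.1)
      (ContinuousLinearMap.snd ℝ E E - (fderiv ℝ Y x₀).comp (ContinuousLinearMap.fst ℝ E E))
      (x₀, y₀) :=
    hasFDerivAt_snd.sub (hY.hasFDerivAt.comp (x₀, y₀) hasFDerivAt_fst)
  -- The product rule gives `dp (y₀ - Y) + p (a - DY y₀) - dℓ (y₀, a)`. The terms `p a` cancel
  -- (`h6`), and invariance replaces `-p (DY y₀)` by `∂ℓ/∂q · Y` (`h7`).
  have h4 := ((hpd.clm_apply h3).sub h1).fderiv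
  have h5 : (fun w : E × E ↦ fderiv ℝ ℓ w (0, w.2 - Y w.1) - ℓ w) =
      (fun w ↦ p w (w.2 - Y w.1)) - ℓ := rfl
  rw [h5, h4]
  have h6 : fderiv ℝ ℓ (x₀, y₀) (y₀, a) = fderiv ℝ ℓ (x₀, y₀) (y₀, 0) + p (x₀, y₀) a := by
    rw [hp]
    simp [← map_add]
  have h7 : fderiv ℝ ℓ (x₀, y₀) (Y x₀, 0) + p (x₀, y₀) (fderiv ℝ Y x₀ y₀) = 0 := by
    rw [← hinv, hp]
    simp [← map_add]
  simp only [_root_.sub_apply, _root_.add_apply,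
    ContinuousLinearMap.comp_apply, ContinuousLinearMap.flip_apply,
    ContinuousLinearMap.coe_fst', ContinuousLinearMap.coe_snd', ContinuousLinearMap.inl_apply,
    map_sub]
  have h8 : fderiv ℝ ℓ (x₀, y₀) (y₀ - Y x₀, 0) =
      fderiv ℝ ℓ (x₀, y₀) (y₀, 0) - fderiv ℝ ℓ (x₀, y₀) (Y x₀, 0) := by
    rw [← map_sub]; simp
  linarith

end Calculus

/-! ### Momentum and energy in bundle coordinates. -/

section Coordinates

variable {E : Type*} [NormedAddCommGroup E] [NormedSpace ℝ E]
  {H : Type*} [TopologicalSpace H] {I : ModelWithCorners ℝ E H}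
  {Q : Type*} [TopologicalSpace Q] [ChartedSpace H Q] [IsManifold I ∞ Q]

theorem extChartAt_tangent_apply (v w : TangentBundle I Q) :
    extChartAt I.tangent v w = (extChartAt I v.proj w.proj,
      (tangentCoordChange I w.proj v.proj w.proj w.snd : E)) := rfl

theorem extChartAt_tangent_self (v : TangentBundle I Q) :
    extChartAt I.tangent v v = (extChartAt I v.proj v.proj, (v.snd : E)) := by
  rw [extChartAt_tangent_apply]
  exact congrArg _ (tangentCoordChange_self (mem_extChartAt_source v.proj))

theorem mem_extChartAt_tangent_source {v w : TangentBundle I Q} :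
    w ∈ (extChartAt I.tangent v).source ↔ w.proj ∈ (extChartAt I v.proj).source := by
  rw [extChartAt_source, extChartAt_source]
  exact TangentBundle.mem_chart_source_iff w v

theorem mfderiv_extChartAt_eq {q x : Q} (hx : x ∈ (extChartAt I q).source) :
    mfderiv I 𝓘(ℝ, E) (extChartAt I q) x = tangentCoordChange I x q x := by
  rw [extChartAt_source] at hx
  rw [(hasMFDerivAt_extChartAt hx).mfderiv]
  exact mfderiv_chartAt_eq_tangentCoordChange hx

/-- The tangent space at `q` is modelled on `E` through the preferred chart at `q`, so the
differential of that chart at `q` is the identity. -/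
theorem mfderiv_extChartAt_self (q : Q) (u : E) :
    (mfderiv I 𝓘(ℝ, E) (extChartAt I q) q : E →L[ℝ] E) u = u := by
  have h := mfderiv_extChartAt_eq (I := I) (mem_extChartAt_source (I := I) q)
  have h2 : tangentCoordChange I q q q u = u := tangentCoordChange_self (mem_extChartAt_source q)
  exact (DFunLike.congr_fun h u).trans h2

theorem mem_extChartAt_tangent_target {v : TangentBundle I Q} {z : E × E} :
    z ∈ (extChartAt I.tangent v).target ↔ z.1 ∈ (extChartAt I v.proj).target := by
  have h := FiberBundle.extChartAt_target (IB := I) (F := E) (E := TangentSpace I) v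
  change z ∈ (extChartAt (I.prod 𝓘(ℝ, E)) v).target ↔ _
  rw [h]
  simp only [Set.mem_prod, Set.mem_univ, and_true, Set.mem_inter_iff, Set.mem_preimage,
    and_iff_left_iff_imp]
  intro hz
  rw [TangentBundle.trivializationAt_baseSet, ← extChartAt_source I]
  exact (extChartAt I v.proj).map_target hz

/-- The local representative of a vector field in the chart around `q`. -/
noncomputable def coordField (Y : ∀ q : Q, TangentSpace I q) (q : Q) (x : E) : E :=
  tangentCoordChange I ((extChartAt I q).symm x) q ((extChartAt I q).symm x)
    (Y ((extChartAt I q).symm x))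

theorem coordField_self (Y : ∀ q : Q, TangentSpace I q) (q : Q) :
    coordField Y q (extChartAt I q q) = Y q := by
  simp only [coordField]
  rw [extChartAt_to_inv]
  exact tangentCoordChange_self (mem_extChartAt_source q)

theorem contDiffOn_coordField {Y : ∀ q : Q, TangentSpace I q}
    (hY : ContMDiff I I.tangent ∞ fun q ↦ (⟨q, Y q⟩ : TangentBundle I Q)) (q : Q) :
    ContDiffOn ℝ ∞ (coordField Y q) (extChartAt I q).target := by
  have h1 : ContMDiffOn 𝓘(ℝ, E) I.tangent ∞
      (fun x : E ↦ (⟨(extChartAt I q).symm x, Y ((extChartAt I q).symm x)⟩ : TangentBundle I Q))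
      (extChartAt I q).target :=
    hY.comp_contMDiffOn (contMDiffOn_extChartAt_symm q)
  have h2 : ContMDiffOn I.tangent 𝓘(ℝ, E × E) ∞
      (extChartAt I.tangent (⟨q, 0⟩ : TangentBundle I Q)) _ :=
    contMDiffOn_extChartAt
  -- The fibre component of the section `Y`, read in the bundle chart, is `coordField Y q`.
  have h3 := h2.comp h1 fun x hx ↦ by
    rw [Set.mem_preimage, TangentBundle.mem_chart_source_iff, ← extChartAt_source I]
    exact (extChartAt I q).map_target hx
  exact (contMDiffOn_iff_contDiffOn.1 h3).snd

theorem contDiffOn_coordLagrangian {L : TangentBundle I Q → ℝ}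
    (hL : ContMDiff I.tangent 𝓘(ℝ, ℝ) ∞ L) (v : TangentBundle I Q) :
    ContDiffOn ℝ ∞ (coordLagrangian L v) (extChartAt I.tangent v).target :=
  contMDiffOn_iff_contDiffOn.1 (hL.comp_contMDiffOn (contMDiffOn_extChartAt_symm v))

theorem coordLagrangian_extChartAt (L : TangentBundle I Q → ℝ) {v w : TangentBundle I Q}
    (hw : w.proj ∈ (extChartAt I v.proj).source) :
    coordLagrangian L v (extChartAt I.tangent v w) = L w :=
  congrArg L ((extChartAt I.tangent v).left_inv (mem_extChartAt_tangent_source.2 hw))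

/-- In coordinates, the first component of a tangent vector to `TQ` is its projection to `Q`. -/
theorem fst_mfderiv_extChartAt_tangent (v : TangentBundle I Q) (a : TangentSpace I.tangent v) :
    (mfderiv I.tangent 𝓘(ℝ, E × E) (extChartAt I.tangent v) v a : E × E).1 =
      (mfderiv I.tangent I (fun w : TangentBundle I Q ↦ w.proj) v a : E) := by
  have h2 : HasMFDerivAt I.tangent 𝓘(ℝ, E × E) (extChartAt I.tangent v) v _ :=
    (mdifferentiableAt_extChartAt (mem_chart_source _ v)).hasMFDerivAt
  have h3 : HasMFDerivAt 𝓘(ℝ, E × E) 𝓘(ℝ, E) Prod.fst (extChartAt I.tangent v v)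
    (ContinuousLinearMap.fst ℝ E E) := hasFDerivAt_fst.hasMFDerivAt
  have h4 : HasMFDerivAt I.tangent I (fun w : TangentBundle I Q ↦ w.proj) v _ :=
    ((contMDiff_proj (TangentSpace I) (n := ∞)).mdifferentiableAt (by simp)).hasMFDerivAt
  have h5 : HasMFDerivAt I 𝓘(ℝ, E) (extChartAt I v.proj) v.proj _ :=
    (mdifferentiableAt_extChartAt (mem_chart_source _ v.proj)).hasMFDerivAt
  -- The first component of the bundle chart is the base chart composed with the projection; the two
  -- expressions for its derivative must coincide.
  have h6 := DFunLike.congr_fun (hasMFDerivAt_unique (h3.comp v h2) (h5.comp v h4)) a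
  exact h6.trans (mfderiv_extChartAt_self v.proj _)

variable [I.Boundaryless]

theorem contDiffAt_coordLagrangian {L : TangentBundle I Q → ℝ}
    (hL : ContMDiff I.tangent 𝓘(ℝ, ℝ) ∞ L) {v w : TangentBundle I Q}
    (hw : w.proj ∈ (extChartAt I v.proj).source) :
    ContDiffAt ℝ ∞ (coordLagrangian L v) (extChartAt I.tangent v w) :=
  (contDiffOn_coordLagrangian hL v).contDiffAt ((isOpen_extChartAt_target v).mem_nhds
    ((extChartAt I.tangent v).map_source (mem_extChartAt_tangent_source.2 hw)))

/-- The momentum covector in the bundle coordinates around `v`. -/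
theorem momentum_eq_fderiv_coordLagrangian {L : TangentBundle I Q → ℝ}
    (hL : ContMDiff I.tangent 𝓘(ℝ, ℝ) ∞ L) {v w : TangentBundle I Q}
    (hw : w.proj ∈ (extChartAt I v.proj).source) (y : TangentSpace I w.proj) :
    momentum L w y = fderiv ℝ (coordLagrangian L v) (extChartAt I.tangent v w)
      (0, tangentCoordChange I w.proj v.proj w.proj y) := by
  let w' : E := w.snd
  let A : E →L[ℝ] E := tangentCoordChange I w.proj v.proj w.proj
  have h1 : (fun u : E ↦ L ⟨w.proj, u⟩) =
      fun u : E ↦ coordLagrangian L v (extChartAt I v.proj w.proj, A u) :=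
    funext fun u ↦ (coordLagrangian_extChartAt L (v := v) (w := ⟨w.proj, u⟩) hw).symm
  have h2 : HasFDerivAt (coordLagrangian L v) _ (extChartAt I v.proj w.proj, A w') :=
    ((contDiffAt_coordLagrangian hL hw).differentiableAt (by simp)).hasFDerivAt
  have h3 := h2.comp w'
    ((hasFDerivAt_const (extChartAt I v.proj w.proj) w').prodMk A.hasFDerivAt)
  have h4 := h3.fderiv
  rw [Function.comp_def, ← h1] at h4
  exact DFunLike.congr_fun h4 y

/-- The energy minus the momentum component of `Y`, in bundle coordinates around `v`. -/
noncomputable def coordMovingEnergy (L : TangentBundle I Q → ℝ) (Y : ∀ q : Q, TangentSpace I q)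
    (v : TangentBundle I Q) (z : E × E) : ℝ :=
  fderiv ℝ (coordLagrangian L v) z (0, z.2 - coordField Y v.proj z.1) - coordLagrangian L v z

/-- Both terms use the same fibre derivative, so they merge into one evaluation on `w - Y`. Validity
on the whole chart domain, with `v` fixed, is what allows the coordinate expression to be
differentiated. -/
theorem energy_sub_momentum_eq_coordMovingEnergy {L : TangentBundle I Q → ℝ}
    (hL : ContMDiff I.tangent 𝓘(ℝ, ℝ) ∞ L) (Y : ∀ q : Q, TangentSpace I q)
    {v w : TangentBundle I Q} (hw : w.proj ∈ (extChartAt I v.proj).source) :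
    energy L w - momentum L w (Y w.proj) =
      coordMovingEnergy L Y v (extChartAt I.tangent v w) := by
  have hY : coordField Y v.proj (extChartAt I v.proj w.proj) =
      (tangentCoordChange I w.proj v.proj w.proj (Y w.proj) : E) := by
    simp only [coordField]
    rw [(extChartAt I v.proj).left_inv hw]
  rw [energy, momentum_eq_fderiv_coordLagrangian hL hw, momentum_eq_fderiv_coordLagrangian hL hw,
    coordMovingEnergy, coordLagrangian_extChartAt L hw]
  rw [extChartAt_tangent_apply]
  simp only []
  rw [hY, sub_right_comm, ← map_sub, Prod.mk_sub_mk, sub_zero]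

theorem contDiffOn_coordMovingEnergy {L : TangentBundle I Q → ℝ}
    (hL : ContMDiff I.tangent 𝓘(ℝ, ℝ) ∞ L) {Y : ∀ q : Q, TangentSpace I q}
    (hY : ContMDiff I I.tangent ∞ fun q ↦ (⟨q, Y q⟩ : TangentBundle I Q))
    (v : TangentBundle I Q) :
    ContDiffOn ℝ ∞ (coordMovingEnergy L Y v) (extChartAt I.tangent v).target := by
  have hL' := contDiffOn_coordLagrangian hL v
  have h1 : ContDiffOn ℝ ∞ (fderiv ℝ (coordLagrangian L v)) (extChartAt I.tangent v).target :=
    hL'.fderiv_of_isOpen (isOpen_extChartAt_target v) (by simp)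
  have h2 : ContDiffOn ℝ ∞ (fun z : E × E ↦ coordField Y v.proj z.1)
      (extChartAt I.tangent v).target :=
    (contDiffOn_coordField hY v.proj).comp contDiff_fst.contDiffOn
      fun z hz ↦ mem_extChartAt_tangent_target.1 hz
  exact (h1.clm_apply (contDiffOn_const.prodMk (contDiff_snd.contDiffOn.sub h2))).sub hL'

theorem energy_sub_momentum_eventuallyEq {L : TangentBundle I Q → ℝ}
    (hL : ContMDiff I.tangent 𝓘(ℝ, ℝ) ∞ L) (Y : ∀ q : Q, TangentSpace I q)
    (v : TangentBundle I Q) :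
    (fun w ↦ energy L w - momentum L w (Y w.proj)) =ᶠ[𝓝 v]
      coordMovingEnergy L Y v ∘ extChartAt I.tangent v := by
  filter_upwards [extChartAt_source_mem_nhds (I := I.tangent) v] with w hw
  exact energy_sub_momentum_eq_coordMovingEnergy hL Y (mem_extChartAt_tangent_source.1 hw)

theorem contDiffAt_coordMovingEnergy {L : TangentBundle I Q → ℝ}
    (hL : ContMDiff I.tangent 𝓘(ℝ, ℝ) ∞ L) {Y : ∀ q : Q, TangentSpace I q}
    (hY : ContMDiff I I.tangent ∞ fun q ↦ (⟨q, Y q⟩ : TangentBundle I Q))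
    (v : TangentBundle I Q) :
    ContDiffAt ℝ ∞ (coordMovingEnergy L Y v) (extChartAt I.tangent v v) :=
  (contDiffOn_coordMovingEnergy hL hY v).contDiffAt
    ((isOpen_extChartAt_target v).mem_nhds (mem_extChartAt_target v))

theorem contMDiff_energy_sub_momentum {L : TangentBundle I Q → ℝ}
    (hL : ContMDiff I.tangent 𝓘(ℝ, ℝ) ∞ L) {Y : ∀ q : Q, TangentSpace I q}
    (hY : ContMDiff I I.tangent ∞ fun q ↦ (⟨q, Y q⟩ : TangentBundle I Q)) :
    ContMDiff I.tangent 𝓘(ℝ, ℝ) ∞ fun w ↦ energy L w - momentum L w (Y w.proj) := fun v ↦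
  ((contDiffAt_coordMovingEnergy hL hY v).contMDiffAt.comp v contMDiffAt_extChartAt)
    |>.congr_of_eventuallyEq (energy_sub_momentum_eventuallyEq hL Y v)

theorem hasMFDerivAt_energy_sub_momentum {L : TangentBundle I Q → ℝ}
    (hL : ContMDiff I.tangent 𝓘(ℝ, ℝ) ∞ L) {Y : ∀ q : Q, TangentSpace I q}
    (hY : ContMDiff I I.tangent ∞ fun q ↦ (⟨q, Y q⟩ : TangentBundle I Q))
    (v : TangentBundle I Q) :
    HasMFDerivAt I.tangent 𝓘(ℝ, ℝ) (fun w ↦ energy L w - momentum L w (Y w.proj)) v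
      ((fderiv ℝ (coordMovingEnergy L Y v) (extChartAt I.tangent v v)).comp
        (mfderiv I.tangent 𝓘(ℝ, E × E) (extChartAt I.tangent v) v)) := by
  have h1 := ((contDiffAt_coordMovingEnergy hL hY v).differentiableAt
    (by simp)).hasFDerivAt.hasMFDerivAt
  have h2 : HasMFDerivAt I.tangent 𝓘(ℝ, E × E) (extChartAt I.tangent v) v _ :=
    (mdifferentiableAt_extChartAt (mem_chart_source _ v)).hasMFDerivAt
  exact (h1.comp v h2).congr_of_eventuallyEq (energy_sub_momentum_eventuallyEq hL Y v)

end Coordinates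

/-! ### Invariance of the Lagrangian and the derivative of the moving energy. -/

section Noether

variable {E : Type*} [NormedAddCommGroup E] [NormedSpace ℝ E]
  {H : Type*} [TopologicalSpace H] {I : ModelWithCorners ℝ E H} [I.Boundaryless]
  {Q : Type*} [TopologicalSpace Q] [ChartedSpace H Q] [IsManifold I ∞ Q]

/-- A Lagrangian that is invariant under the tangent lift of the flow of `Y` is annihilated, in
bundle coordinates, by the tangent lift of `Y`. -/
theorem fderiv_coordLagrangian_tangentLift {L : TangentBundle I Q → ℝ}
    (hL : ContMDiff I.tangent 𝓘(ℝ, ℝ) ∞ L) {Φ : Q → ℝ → Q} {Y : ∀ q : Q, TangentSpace I q}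
    (hΦ : ContMDiff (I.prod 𝓘(ℝ, ℝ)) I ∞ fun p : Q × ℝ ↦ Φ p.1 p.2) (hflow : IsFlow Φ Y)
    (v : TangentBundle I Q)
    (hinv : ∀ s, L (tangentMap I I (fun q ↦ Φ q s) v) = L v) :
    fderiv ℝ (coordLagrangian L v) (extChartAt I v.proj v.proj, (v.snd : E))
      (coordField Y v.proj (extChartAt I v.proj v.proj),
        fderiv ℝ (coordField Y v.proj) (extChartAt I v.proj v.proj) (v.snd : E)) = 0 := by
  set q := v.proj with hq
  let y₀ : E := v.snd
  let e := extChartAt I q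
  let x₀ : E := e q
  have hex₀ : e.symm x₀ = q := e.left_inv (mem_extChartAt_source q)
  let φ : ℝ × E → E := fun p ↦ e (Φ (e.symm p.2) p.1)
  have hΦs : ∀ s, ContMDiff I I ∞ fun q ↦ Φ q s := fun s ↦
    hΦ.comp (contMDiff_id.prodMk contMDiff_const)
  have hin : ContMDiffAt 𝓘(ℝ, ℝ × E) I ∞ (fun p : ℝ × E ↦ Φ (e.symm p.2) p.1) (0, x₀) := by
    have h1 : ContMDiffAt 𝓘(ℝ, ℝ × E) 𝓘(ℝ, E) ∞ (Prod.snd : ℝ × E → E) (0, x₀) :=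
      contDiff_snd.contMDiff.contMDiffAt
    have h2 : ContMDiffAt 𝓘(ℝ, ℝ × E) 𝓘(ℝ, ℝ) ∞ (Prod.fst : ℝ × E → ℝ) (0, x₀) :=
      contDiff_fst.contMDiff.contMDiffAt
    have h3 : ContMDiffAt 𝓘(ℝ, E) I ∞ e.symm x₀ :=
      (contMDiffOn_extChartAt_symm q).contMDiffAt
        ((isOpen_extChartAt_target q).mem_nhds (mem_extChartAt_target q))
    exact hΦ.contMDiffAt.comp (0, x₀)
      ((ContMDiffAt.comp ((0 : ℝ), x₀) (g := e.symm) h3 h1).prodMk h2)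
  have hpt : Φ (e.symm x₀) 0 = q := by rw [hex₀, (hflow q).1]
  have hφ : ContDiffAt ℝ 2 φ (0, x₀) := by
    have h1 : ContMDiffAt I 𝓘(ℝ, E) ∞ e (Φ (e.symm x₀) 0) := by
      rw [hpt]
      exact contMDiffAt_extChartAt
    exact (contMDiffAt_iff_contDiffAt.1 (ContMDiffAt.comp ((0 : ℝ), x₀) (g := e) h1 hin)).of_le
      ENat.LEInfty.out
  -- The coordinate flow `φ` is meaningful only while the point and its image stay in the chart;
  -- this holds near `(0, x₀)`, which suffices for derivatives there.
  have hev : ∀ᶠ p in 𝓝 ((0 : ℝ), x₀),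
      DifferentiableAt ℝ φ p ∧ p.2 ∈ e.target ∧ Φ (e.symm p.2) p.1 ∈ e.source := by
    refine ((hφ.eventually (by simp)).mono fun p hp ↦ hp.differentiableAt (by norm_num)).and
      (Filter.Eventually.and ?_ ?_)
    · exact continuousAt_snd.eventually_mem ((isOpen_extChartAt_target q).mem_nhds
        (mem_extChartAt_target q))
    · refine hin.continuousAt.eventually_mem ?_
      change e.source ∈ 𝓝 (Φ (e.symm x₀) 0)
      rw [hpt]
      exact extChartAt_source_mem_nhds q
  have hevs : ∀ᶠ s in 𝓝 (0 : ℝ), DifferentiableAt ℝ φ (s, x₀) ∧ x₀ ∈ e.target ∧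
      Φ (e.symm x₀) s ∈ e.source :=
    (Continuous.prodMk_left x₀).continuousAt.eventually hev
  have hevx : ∀ᶠ x in 𝓝 x₀, DifferentiableAt ℝ φ (0, x) ∧ x ∈ e.target ∧
      Φ (e.symm x) 0 ∈ e.source :=
    (Continuous.prodMk_right (0 : ℝ)).continuousAt.eventually hev
  -- In bundle coordinates the tangent lift of the flow is `(φ_s, D φ_s)`; this is the chain rule
  -- for `e ∘ Φ_s = φ_s ∘ e` near `q`.
  have hlift : ∀ s, DifferentiableAt ℝ φ (s, x₀) → Φ q s ∈ e.source →
      extChartAt I.tangent v (tangentMap I I (fun q ↦ Φ q s) v) =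
        (φ (s, x₀), fderiv ℝ φ (s, x₀) (0, y₀)) := by
    intro s hs hsrc
    rw [extChartAt_tangent_apply]
    refine Prod.ext ?_ ?_
    · change e (Φ q s) = e (Φ (e.symm x₀) s)
      rw [hex₀]
    · let A : E →L[ℝ] E := tangentCoordChange I (Φ q s) q (Φ q s)
      have h1 : HasMFDerivAt I 𝓘(ℝ, E) e (Φ q s) A := by
        change HasMFDerivAt I 𝓘(ℝ, E) e (Φ q s) (tangentCoordChange I (Φ q s) q (Φ q s) :)
        rw [← mfderiv_extChartAt_eq hsrc]
        exact (mdifferentiableAt_extChartAt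
          (by rwa [← extChartAt_source I])).hasMFDerivAt
      have h2 : HasMFDerivAt I I (fun q ↦ Φ q s) q (mfderiv I I (fun q ↦ Φ q s) q) :=
        ((hΦs s).mdifferentiableAt (by simp)).hasMFDerivAt
      have h3 : HasMFDerivAt I 𝓘(ℝ, E) e q (mfderiv I 𝓘(ℝ, E) e q) :=
        (mdifferentiableAt_extChartAt (mem_chart_source _ q)).hasMFDerivAt
      have h4 : HasFDerivAt (fun x : E ↦ φ (s, x))
          ((fderiv ℝ φ (s, x₀)).comp (ContinuousLinearMap.inr ℝ ℝ E)) x₀ :=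
        hs.hasFDerivAt.comp x₀ (hasFDerivAt_prodMk_right s x₀)
      have h5 : (e ∘ fun q ↦ Φ q s) =ᶠ[𝓝 q] (fun x : E ↦ φ (s, x)) ∘ e := by
        filter_upwards [extChartAt_source_mem_nhds (I := I) q] with r hr
        change e (Φ r s) = e (Φ (e.symm (e r)) s)
        rw [e.left_inv hr]
      have h6 := hasMFDerivAt_unique (h1.comp q h2)
        ((HasMFDerivAt.comp q h4.hasMFDerivAt h3).congr_of_eventuallyEq h5)
      refine (DFunLike.congr_fun h6 y₀).trans ?_
      exact congrArg (fun u : E ↦ fderiv ℝ φ (s, x₀) (0, u)) (mfderiv_extChartAt_self q y₀)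
  have hz : DifferentiableAt ℝ (coordLagrangian L v) (x₀, y₀) := by
    have h := (contDiffAt_coordLagrangian hL (v := v) (mem_extChartAt_source v.proj)).differentiableAt
      (by simp)
    rwa [extChartAt_tangent_self] at h
  have hx : φ (0, x₀) = x₀ := congrArg e hpt
  have hy : fderiv ℝ φ (0, x₀) (0, y₀) = y₀ := by
    have h := hlift 0 hevs.self_of_nhds.1 (hex₀ ▸ hevs.self_of_nhds.2.2)
    have h1 : (fun q ↦ Φ q 0) = id := funext fun q ↦ (hflow q).1
    rw [h1, tangentMap_id, id, extChartAt_tangent_self] at h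
    exact (congrArg Prod.snd h).symm
  refine fderiv_tangentLift_eq_zero (c := L v) hz hφ hx hy ?_ ?_
  · filter_upwards [hevs] with s hs
    rw [hex₀] at hs
    rw [← hlift s hs.1 hs.2.2, coordLagrangian_extChartAt L (v := v) hs.2.2, hinv s]
  -- The coordinate field is the time derivative of `φ` at `0`: the flow equation at `e.symm x`,
  -- pushed through the chart.
  · filter_upwards [hevx] with x hx
    have hsrc := hx.2.2
    have h1 : HasMFDerivAt I 𝓘(ℝ, E) e (Φ (e.symm x) 0)
        (mfderiv I 𝓘(ℝ, E) e (Φ (e.symm x) 0)) :=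
      (mdifferentiableAt_extChartAt (by rwa [← extChartAt_source I])).hasMFDerivAt
    have h2 := hasMFDerivWithinAt_comp_curve h1
      (((hflow (e.symm x)).2 0).hasMFDerivWithinAt (s := Set.univ))
    let d : E := mfderiv I 𝓘(ℝ, E) e (Φ (e.symm x) 0) (Y (Φ (e.symm x) 0))
    have h3 : HasFDerivAt (fun s : ℝ ↦ φ (s, x)) ((1 : ℝ →L[ℝ] ℝ).smulRight d) 0 :=
      (hasMFDerivWithinAt_univ.1 h2).hasFDerivAt
    have hs : HasDerivAt (fun s : ℝ ↦ (s, x)) (1, 0) (0 : ℝ) :=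
      (hasDerivAt_id _).prodMk (hasDerivAt_const _ _)
    have h4 : HasDerivAt (fun s : ℝ ↦ φ (s, x)) (fderiv ℝ φ (0, x) (1, 0)) 0 :=
      HasFDerivAt.comp_hasDerivAt (l := φ) (0 : ℝ) hx.1.hasFDerivAt hs
    have h5 : (mfderiv I 𝓘(ℝ, E) e (Φ (e.symm x) 0) (Y (Φ (e.symm x) 0)) : E) =
        fderiv ℝ φ (0, x) (1, 0) :=
      (one_smul ℝ d).symm.trans (h3.hasDerivAt.unique h4)
    rw [← h5, (hflow (e.symm x)).1, mfderiv_extChartAt_eq (e.map_target hx.2.1)]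
    rfl

/-- The derivative of `E_L - ⟨p, Y⟩` along a second-order vector is the Lagrange covector
evaluated on `v - Y`, if `L` is invariant under the flow of `Y`. -/
theorem mfderiv_energy_sub_momentum_of_invariant {L : TangentBundle I Q → ℝ}
    (hL : ContMDiff I.tangent 𝓘(ℝ, ℝ) ∞ L) {Φ : Q → ℝ → Q} {Y : ∀ q : Q, TangentSpace I q}
    (hΦ : ContMDiff (I.prod 𝓘(ℝ, ℝ)) I ∞ fun p : Q × ℝ ↦ Φ p.1 p.2) (hflow : IsFlow Φ Y)
    (hY : ContMDiff I I.tangent ∞ fun q ↦ (⟨q, Y q⟩ : TangentBundle I Q))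
    (v : TangentBundle I Q)
    (hinv : ∀ s, L (tangentMap I I (fun q ↦ Φ q s) v) = L v) (a : TangentSpace I.tangent v)
    (ha : mfderiv I.tangent I (fun w : TangentBundle I Q ↦ w.proj) v a = v.snd) :
    (mfderiv I.tangent 𝓘(ℝ, ℝ) (fun w ↦ energy L w - momentum L w (Y w.proj)) v a : ℝ) =
      lagrangeCovector L v a (v.snd - Y v.proj) := by
  rw [(hasMFDerivAt_energy_sub_momentum hL hY v).mfderiv]
  let dz : E × E := mfderiv I.tangent 𝓘(ℝ, E × E) (extChartAt I.tangent v) v a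
  let y₀ : E := v.snd
  let Yq : E := Y v.proj
  let x₀ : E := extChartAt I v.proj v.proj
  have hz : extChartAt I.tangent v v = (x₀, y₀) := extChartAt_tangent_self v
  -- The second-order condition fixes the base component of `dz`; the acceleration `dz.2` stays
  -- arbitrary.
  have hdz : dz = (y₀, dz.2) :=
    Prod.ext ((fst_mfderiv_extChartAt_tangent v a).trans ha) rfl
  have hL2 : ContDiffAt ℝ 2 (coordLagrangian L v) (x₀, y₀) := by
    rw [← hz]
    exact (contDiffAt_coordLagrangian hL (mem_extChartAt_source v.proj)).of_le
      ENat.LEInfty.out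
  have hYd : DifferentiableAt ℝ (coordField Y v.proj) x₀ :=
    ((contDiffOn_coordField hY v.proj).contDiffAt ((isOpen_extChartAt_target v.proj).mem_nhds
      (mem_extChartAt_target v.proj))).differentiableAt (by simp)
  have key := fderiv_energy_sub_momentum dz.2 hL2 hYd
    (fderiv_coordLagrangian_tangentLift hL hΦ hflow v hinv)
  have hl : (lagrangeCovector L v a (v.snd - Y v.proj) : ℝ) =
      (fderiv ℝ (fun w : E × E ↦ (fderiv ℝ (coordLagrangian L v) w).comp
          (ContinuousLinearMap.inr ℝ E E)) (extChartAt I.tangent v v) dz -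
        (fderiv ℝ (coordLagrangian L v) (extChartAt I.tangent v v)).comp
          (ContinuousLinearMap.inl ℝ E E))
        ((mfderiv I 𝓘(ℝ, E) (extChartAt I v.proj) v.proj : E →L[ℝ] E)
          (y₀ - Yq)) := rfl
  rw [hl, mfderiv_extChartAt_self, hz, hdz, show Yq = _ from (coordField_self Y v.proj).symm]
  refine Eq.trans ?_ key
  change fderiv ℝ (coordMovingEnergy L Y v) (x₀, y₀) dz = _
  rw [hdz]
  rfl

end Noether

/-! ### From vanishing derivative to first integral. -/

section FirstIntegral

variable {E : Type*} [NormedAddCommGroup E] [NormedSpace ℝ E]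
  {H : Type*} [TopologicalSpace H] {I : ModelWithCorners ℝ E H}
  {Q : Type*} [TopologicalSpace Q] [ChartedSpace H Q] [IsManifold I ∞ Q]

/-- A smooth function whose derivative along `X` vanishes on `M` is a first integral. -/
theorem isFirstIntegral_of_mfderiv_eq_zero {M : Set (TangentBundle I Q)}
    {X : ∀ v : TangentBundle I Q, TangentSpace I.tangent v} {f : TangentBundle I Q → ℝ}
    (hf : ContMDiff I.tangent 𝓘(ℝ, ℝ) ∞ f)
    (h : ∀ v ∈ M, (mfderiv I.tangent 𝓘(ℝ, ℝ) f v (X v) : ℝ) = 0) : IsFirstIntegral M X f := by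
  refine ⟨hf.contMDiffOn, fun γ s hs hγ hM t₁ ht₁ t₂ ht₂ ↦ ?_⟩
  have hder : ∀ t ∈ s, HasDerivWithinAt (fun t ↦ f (γ t)) 0 s t := by
    intro t ht
    have h1 := hasMFDerivWithinAt_comp_curve
      (hf.mdifferentiableAt (x := γ t) (by simp)).hasMFDerivAt (hγ t ht)
    let d : ℝ := mfderiv I.tangent 𝓘(ℝ, ℝ) f (γ t) (X (γ t))
    have h2 : HasFDerivWithinAt (fun t ↦ f (γ t)) ((1 : ℝ →L[ℝ] ℝ).smulRight d) s t := h1.hasFDerivWithinAt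
    refine h2.hasDerivWithinAt.congr_deriv ?_
    exact (one_smul ℝ _).trans (h _ (hM t ht))
  -- Mean value inequality with bound `0`; derivatives within `s` suffice, so endpoints of the
  -- interval are covered.
  have h3 := hs.convex.norm_image_sub_le_of_norm_hasDerivWithin_le (C := 0) hder
    (fun t _ ↦ by simp) ht₁ ht₂
  rw [zero_mul, norm_le_zero_iff, sub_eq_zero] at h3
  exact h3.symm

end FirstIntegral

end MovingEnergy

theorem theorem2
    {E : Type*} [NormedAddCommGroup E] [NormedSpace ℝ E] [FiniteDimensional ℝ E]
    {H : Type*} [TopologicalSpace H] (I : ModelWithCorners ℝ E H) [I.Boundaryless]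
    {Q : Type*} [TopologicalSpace Q] [T2Space Q] [ChartedSpace H Q] [IsManifold I ∞ Q]
    {F : Type*} [NormedAddCommGroup F] [NormedSpace ℝ F] [FiniteDimensional ℝ F]
    {K : Type*} [TopologicalSpace K] (J : ModelWithCorners ℝ F K) [J.Boundaryless]
    {G : Type*} [TopologicalSpace G] [T2Space G] [ChartedSpace K G] [Group G] [LieGroup J ∞ G]
    [MulAction G Q] [ContMDiffSMul J I ∞ G Q]
    (S : MovingEnergy.NonholonomicData I Q)
    (X : ∀ v : TangentBundle I Q, TangentSpace I.tangent v)
    (hX : S.IsNonholonomicSystem X)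
    (H1 : ∀ (g : G) (v : TangentBundle I Q), S.L (tangentMap I I (fun q : Q ↦ g • q) v) = S.L v)
    (H2 : ∀ (g : G) (q : Q), S.D (g • q) =
      (S.D q).map (mfderiv I I (fun q' : Q ↦ g • q') q).toLinearMap)
    (η : GroupLieAlgebra J G)
    (H3 : ∀ q : Q, MovingEnergy.infinitesimalGenerator I η q - S.ξ q ∈ S.D q) :
    MovingEnergy.IsFirstIntegral S.M₀ X
      (fun v ↦ MovingEnergy.energy S.L v - MovingEnergy.momentumMap S.L η v) ∧
    (∃! C : MovingEnergy.TimeDependentDiffeo I I Q Q,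
      MovingEnergy.IsFlow C.map (MovingEnergy.infinitesimalGenerator I η)) ∧
    ∀ C : MovingEnergy.TimeDependentDiffeo I I Q Q,
      MovingEnergy.IsFlow C.map (MovingEnergy.infinitesimalGenerator I η) →
        ∀ (v : TangentBundle I Q) (t : ℝ),
          MovingEnergy.movingEnergy (fun z ↦ S.L z.1) C (v, t) =
            MovingEnergy.energy S.L v - MovingEnergy.momentumMap S.L η v := by
  have hY := MovingEnergy.contMDiff_infinitesimalGenerator (Q := Q) I η
  refine ⟨?_, MovingEnergy.existsUnique_isFlow I η, fun C hC v t ↦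
    MovingEnergy.movingEnergy_eq S.smooth_L C hC v t⟩
  refine MovingEnergy.isFirstIntegral_of_mfderiv_eq_zero
    (MovingEnergy.contMDiff_energy_sub_momentum S.smooth_L hY) fun v hv ↦ ?_
  refine (MovingEnergy.mfderiv_energy_sub_momentum_of_invariant S.smooth_L
    (MovingEnergy.contMDiff_lieExp_smul_smul I η) (MovingEnergy.isFlow_lieExp_smul_smul I η) hY v
    (fun s ↦ H1 _ v) (X v) (hX.second_order v hv)).trans ?_
  obtain ⟨R, hR⟩ := hX.lagrange
  rw [(hR v hv).2]
  refine (hR v hv).1 _ ?_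
  -- The difference of `v - ξ` and `Y - ξ` is `v - Y`, which the reaction force therefore
  -- annihilates.
  have h := (S.D v.proj).sub_mem hv (H3 v.proj)
  rwa [sub_sub_sub_cancel_right] at h
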